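/- Let $A\in\mathbb{R}^{m\times n_x}$, $B\in\mathbb{R}^{m\times n_y}$, $b\in\mathbb{R}^m$, and suppose that the polyhedron $D=\{(x,y)\in\mathbb{R}^{n_x}\times\mathbb{R}^{n_y} : Ax+By\le b\}$ is compact and has nonempty interior. Let $\pi(x,y)=x$ be the projection onto $\mathbb{R}^{n_x}$, let $X=\pi(D)$, and for $x\in X$ let $S(x)=\{y\in\mathbb{R}^{n_y} : (x,y)\in D\}$. A face of $D$ is the set of maximizers over $D$ of a linear functional. For $x\in X$, the chamber of $x$ is $$\sigma(x)=\bigcap\{\pi(F) : F \text{ a face of } D,\ x\in\pi(F)\},$$ and the chamber complex of $D$ is $\mathscr{C}(D)=\{\sigma(x) : x\in X\}$. Then the fiber map $S$ is piecewise affine over $\mathscr{C}(D)$: the collection $\mathscr{C}(D)$ is finite, its union is $X$, and $S$ is affine on every chamber $K\in\mathscr{C}(D)$, that is, $K$ is a convex subset of $X$ and $$S(\eta x_1+(1-\eta)x_0)=\eta S(x_1)+(1-\eta)S(x_0)\qquad\text{for all } x_0,x_1\in K,\ \eta\in(0,1),$$ where the sum on the right-hand side is the Minkowski sum of sets. -/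

import Mathlib

open scoped Pointwise Matrix

/-- The polyhedron `{(x, y) ∈ ℝ^{nx} × ℝ^{ny} : A x + B y ≤ b}` (componentwise inequality). -/
def polyhedron {m nx ny : ℕ} (A : Matrix (Fin m) (Fin nx) ℝ) (B : Matrix (Fin m) (Fin ny) ℝ)
    (b : Fin m → ℝ) : Set ((Fin nx → ℝ) × (Fin ny → ℝ)) :=
  {p | A *ᵥ p.1 + B *ᵥ p.2 ≤ b}

/-- The fiber map `S(x) = {y : (x, y) ∈ D}`. It is empty exactly when `x ∉ π(D)`. -/
def fiberMap {nx ny : ℕ} (D : Set ((Fin nx → ℝ) × (Fin ny → ℝ))) (x : Fin nx → ℝ) :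
    Set (Fin ny → ℝ) :=
  {y | (x, y) ∈ D}

/-- The faces of `D`: the sets `argmax_D l = {p ∈ D | ∀ q ∈ D, l q ≤ l p}`, for `l` a linear
functional. -/
def faces {nx ny : ℕ} (D : Set ((Fin nx → ℝ) × (Fin ny → ℝ))) :
    Set (Set ((Fin nx → ℝ) × (Fin ny → ℝ))) :=
  {F | ∃ l : StrongDual ℝ ((Fin nx → ℝ) × (Fin ny → ℝ)), F = l.toExposed D}

/-- The chamber `σ(x)` of a point: the intersection of the projections `π(F)` of all faces `F`
of `D` with `x ∈ π(F)`. -/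
def chamber {nx ny : ℕ} (D : Set ((Fin nx → ℝ) × (Fin ny → ℝ))) (x : Fin nx → ℝ) :
    Set (Fin nx → ℝ) :=
  ⋂₀ {P | ∃ F ∈ faces D, P = Prod.fst '' F ∧ x ∈ P}

/-- The chamber complex: the collection of the chambers `σ(x)` of the points `x ∈ X = π(D)`. -/
def chamberComplex {nx ny : ℕ} (D : Set ((Fin nx → ℝ) × (Fin ny → ℝ))) :
    Set (Set (Fin nx → ℝ)) :=
  {K | ∃ x ∈ Prod.fst '' D, K = chamber D x}

/-- The domain of a set-valued map. -/
def setValuedDom {nx ny : ℕ} (M : (Fin nx → ℝ) → Set (Fin ny → ℝ)) : Set (Fin nx → ℝ) :=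
  {x | (M x).Nonempty}

/-- A set-valued map `M` is affine on `K`: `K` is a convex subset of the domain of `M`, and `M`
respects convex combinations of points of `K`, sets being added in the sense of Minkowski. -/
def IsSetValuedAffineOn {nx ny : ℕ} (M : (Fin nx → ℝ) → Set (Fin ny → ℝ))
    (K : Set (Fin nx → ℝ)) : Prop :=
  Convex ℝ K ∧ K ⊆ setValuedDom M ∧
    ∀ x₀ ∈ K, ∀ x₁ ∈ K, ∀ η ∈ Set.Ioo (0 : ℝ) 1,
      M (η • x₁ + (1 - η) • x₀) = η • M x₁ + (1 - η) • M x₀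

/-- A set-valued map `M` is piecewise affine over the collection `𝒞`: the collection is finite,
its union is the domain of `M`, and `M` is affine on each of its members. -/
def IsPiecewiseAffineOver {nx ny : ℕ} (M : (Fin nx → ℝ) → Set (Fin ny → ℝ))
    (𝒞 : Set (Set (Fin nx → ℝ))) : Prop :=
  𝒞.Finite ∧ setValuedDom M = ⋃₀ 𝒞 ∧ ∀ K ∈ 𝒞, IsSetValuedAffineOn M K

/-! A compact convex fiber is determined by its support function, so the Minkowski identity on a
chamber reduces to affinity in `x` of the maximum of `u` over `S(x)`, for each functional `u`. LP
duality in the fiber over `z` gives multipliers `c ≥ 0`; with `g = cᵀA`, the functional `g + u` is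
at most `c · b` on all of `D`, with equality somewhere above `z`. Its face projects to a set
containing `z`, hence the whole chamber of `z`, and there the maximum is `c · b - g(x)`. Finiteness
holds because each face is determined by a set of tight inequalities. -/

/-- **Farkas' lemma**: a linear functional that is nonpositive on the polar of finitely many
functionals is a nonnegative combination of them. -/
theorem exists_nonneg_combination_of_polar {V ι : Type*} [AddCommGroup V] [Module ℝ V]
    (s : Finset ι) (a : ι → V →ₗ[ℝ] ℝ) (l : V →ₗ[ℝ] ℝ)
    (h : ∀ d, (∀ i ∈ s, a i d ≤ 0) → l d ≤ 0) :
    ∃ c : ι → ℝ, (∀ i, 0 ≤ c i) ∧ l = ∑ i ∈ s, c i • a i := by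
  classical
  induction s using Finset.induction_on generalizing a l with
  | empty =>
    refine ⟨0, fun _ => le_rfl, ?_⟩
    ext d
    have h₁ := h d (by simp)
    have h₂ := h (-d) (by simp)
    rw [map_neg] at h₂
    simpa using le_antisymm h₁ (by linarith)
  | insert k s hk ih =>
    by_cases hs : ∀ d, (∀ i ∈ s, a i d ≤ 0) → l d ≤ 0
    · obtain ⟨c, hc, hl⟩ := ih a l hs
      refine ⟨Function.update c k 0, fun i => ?_, ?_⟩
      · rcases eq_or_ne i k with rfl | hi
        · simp
        · simpa [hi] using hc i
      · rw [Finset.sum_insert hk, hl]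
        simp only [Function.update_self, zero_smul, zero_add]
        refine Finset.sum_congr rfl fun i hi => ?_
        rw [Function.update_of_ne (ne_of_mem_of_not_mem hi hk)]
    · push Not at hs
      obtain ⟨e, he, hle⟩ := hs
      have hke : 0 < a k e := by
        by_contra! hcon
        exact absurd (h e ((Finset.forall_mem_insert _ _ _).2 ⟨hcon, he⟩)) (not_le.2 hle)
      -- Project along `e` onto the kernel of `a k`: the corrected functionals vanish at `e`.
      obtain ⟨c, hc, hl⟩ := ih (fun i => a i - (a i e / a k e) • a k)
        (l - (l e / a k e) • a k) (by
          intro d hd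
          have key : ∀ g : V →ₗ[ℝ] ℝ,
              g (d - (a k d / a k e) • e) = (g - (g e / a k e) • a k) d := by
            intro g
            simp only [map_sub, map_smul, smul_eq_mul, LinearMap.sub_apply, LinearMap.smul_apply]
            ring
          rw [← key]
          refine h _ ((Finset.forall_mem_insert _ _ _).2 ⟨?_, fun i hi => ?_⟩)
          · rw [key, div_self hke.ne']
            simp
          · rw [key]
            exact hd i hi)
      have hcoef : 0 ≤ (l e - ∑ i ∈ s, c i * a i e) / a k e := by
        refine div_nonneg (sub_nonneg.2 (le_trans ?_ hle.le)) hke.le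
        exact Finset.sum_nonpos fun i hi => mul_nonpos_of_nonneg_of_nonpos (hc i) (he i hi)
      -- The coefficient of `a k` is forced by evaluating the identity at `e`.
      refine ⟨Function.update c k ((l e - ∑ i ∈ s, c i * a i e) / a k e), fun i => ?_, ?_⟩
      · rcases eq_or_ne i k with rfl | hi
        · simpa using hcoef
        · simpa [hi] using hc i
      · have hupd : ∑ i ∈ s, Function.update c k ((l e - ∑ i ∈ s, c i * a i e) / a k e) i • a i =
            ∑ i ∈ s, c i • a i := Finset.sum_congr rfl fun i hi => by
          rw [Function.update_of_ne (ne_of_mem_of_not_mem hi hk)]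
        rw [Finset.sum_insert hk, hupd, Function.update_self]
        ext d
        have hd := LinearMap.congr_fun hl d
        simp only [LinearMap.sub_apply, LinearMap.smul_apply, LinearMap.sum_apply, smul_eq_mul,
          LinearMap.add_apply, mul_sub, Finset.sum_sub_distrib] at hd ⊢
        have hsum : ∑ i ∈ s, c i * (a i e / a k e * a k d) =
            (∑ i ∈ s, c i * a i e) / a k e * a k d := by
          rw [Finset.sum_div, Finset.sum_mul]
          exact Finset.sum_congr rfl fun i _ => by ring
        rw [hsum] at hd
        rw [sub_div, sub_mul]
        linarith

/-- **Linear programming duality** with complementary slackness: a functional that is maximal at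
a point of a polyhedron is a nonnegative combination of the constraints active there. -/
theorem exists_multipliers_of_forall_le {V ι : Type*} [AddCommGroup V] [Module ℝ V] [Fintype ι]
    (a : ι → V →ₗ[ℝ] ℝ) (b : ι → ℝ) (l : V →ₗ[ℝ] ℝ) {p : V} (hp : ∀ i, a i p ≤ b i)
    (hl : ∀ q, (∀ i, a i q ≤ b i) → l q ≤ l p) :
    ∃ c : ι → ℝ, (∀ i, 0 ≤ c i) ∧ (∀ q, l q = ∑ i, c i * a i q) ∧
      l p = ∑ i, c i * b i := by
  classical
  obtain ⟨c, hc, hlc⟩ := exists_nonneg_combination_of_polar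
    (Finset.univ.filter fun i => a i p = b i) a l (by
      intro d hd
      -- Slack constraints survive a small step along `d`, and active ones do not increase.
      have hev : ∀ᶠ t : ℝ in nhdsWithin 0 (Set.Ioi 0), ∀ i, a i (p + t • d) ≤ b i := by
        rw [Filter.eventually_all]
        intro i
        simp only [map_add, map_smul, smul_eq_mul]
        rcases (hp i).lt_or_eq with hi | hi
        · have hcont : Filter.Tendsto (fun t : ℝ => a i p + t * a i d)
              (nhdsWithin 0 (Set.Ioi 0)) (nhds (a i p + 0 * a i d)) :=
            (Continuous.tendsto (by fun_prop) 0).mono_left nhdsWithin_le_nhds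
          rw [zero_mul, add_zero] at hcont
          exact (hcont.eventually (gt_mem_nhds hi)).mono fun t ht => ht.le
        · filter_upwards [self_mem_nhdsWithin] with t ht
          have := mul_nonpos_of_nonneg_of_nonpos (le_of_lt ht) (hd i (by simpa using hi))
          linarith
      obtain ⟨t, ht, ht₀⟩ := (hev.and self_mem_nhdsWithin).exists
      have h := hl _ ht
      rw [map_add, map_smul, smul_eq_mul] at h
      have ht₀' : (0 : ℝ) < t := ht₀
      by_contra! hcon
      have := mul_pos ht₀' hcon
      linarith)
  have hq : ∀ q, l q = ∑ i, (if a i p = b i then c i else 0) * a i q := by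
    intro q
    rw [hlc, Finset.sum_filter]
    simp only [LinearMap.sum_apply]
    refine Finset.sum_congr rfl fun i _ => ?_
    split_ifs <;> simp
  refine ⟨fun i => if a i p = b i then c i else 0, fun i => ?_, hq, ?_⟩
  · dsimp only
    split_ifs
    exacts [hc i, le_rfl]
  · rw [hq]
    refine Finset.sum_congr rfl fun i _ => ?_
    dsimp only
    split_ifs with h
    · rw [h]
    · simp

/-! ### Faces and fibers of a polyhedron -/

section Polyhedron

variable {m nx ny : ℕ} (A : Matrix (Fin m) (Fin nx) ℝ) (B : Matrix (Fin m) (Fin ny) ℝ)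
  (b : Fin m → ℝ)

/-- The left-hand side of the `i`-th inequality of the system `A x + B y ≤ b`. -/
def constraint (i : Fin m) : ((Fin nx → ℝ) × (Fin ny → ℝ)) →ₗ[ℝ] ℝ :=
  (LinearMap.proj i ∘ₗ A.mulVecLin).coprod (LinearMap.proj i ∘ₗ B.mulVecLin)

theorem constraint_apply (i : Fin m) (p : (Fin nx → ℝ) × (Fin ny → ℝ)) :
    constraint A B i p = (A *ᵥ p.1) i + (B *ᵥ p.2) i := by
  simp [constraint]

theorem mem_polyhedron_iff (p : (Fin nx → ℝ) × (Fin ny → ℝ)) :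
    p ∈ polyhedron A B b ↔ ∀ i, constraint A B i p ≤ b i := by
  simp only [constraint_apply]
  rfl

theorem convex_polyhedron : Convex ℝ (polyhedron A B b) := by
  have h : polyhedron A B b = ⋂ i, {p | constraint A B i p ≤ b i} := by
    ext p
    simp [mem_polyhedron_iff]
  rw [h]
  exact convex_iInter fun i => convex_halfSpace_le (constraint A B i).isLinear (b i)

variable {A B b}

/-- A face of a compact polyhedron is cut out by making some of the inequalities tight. -/
theorem exists_tight_of_mem_faces (hcompact : IsCompact (polyhedron A B b))
    (hne : (polyhedron A B b).Nonempty) {F : Set ((Fin nx → ℝ) × (Fin ny → ℝ))}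
    (hF : F ∈ faces (polyhedron A B b)) :
    ∃ I : Set (Fin m), F = {p ∈ polyhedron A B b | ∀ i ∈ I, constraint A B i p = b i} := by
  obtain ⟨l, rfl⟩ := hF
  obtain ⟨p, hp, hmax⟩ := hcompact.exists_isMaxOn hne l.continuous.continuousOn
  obtain ⟨c, hc, hl, hlp⟩ := exists_multipliers_of_forall_le (constraint A B) b l.toLinearMap
    ((mem_polyhedron_iff A B b p).1 hp)
    fun q hq => hmax ((mem_polyhedron_iff A B b q).2 hq)
  simp only [ContinuousLinearMap.coe_coe] at hl hlp
  have hslack : ∀ q, l p - l q = ∑ i, c i * (b i - constraint A B i q) := fun q => by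
    rw [hlp, hl, ← Finset.sum_sub_distrib]
    exact Finset.sum_congr rfl fun i _ => by ring
  -- The gap to the maximum is a sum of nonnegative terms, so it vanishes exactly when every
  -- constraint of nonzero weight is tight.
  refine ⟨{i | c i ≠ 0}, Set.ext fun q => and_congr_right fun hq => ?_⟩
  have hnonneg : ∀ i ∈ Finset.univ, 0 ≤ c i * (b i - constraint A B i q) := fun i _ =>
    mul_nonneg (hc i) (sub_nonneg.2 ((mem_polyhedron_iff A B b q).1 hq i))
  constructor
  · intro hmaxq i hi
    have h0 : ∑ i, c i * (b i - constraint A B i q) = 0 := by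
      rw [← hslack, sub_eq_zero]
      exact le_antisymm (hmaxq p hp) (hmax hq)
    have := (Finset.sum_eq_zero_iff_of_nonneg hnonneg).1 h0 i (Finset.mem_univ i)
    have := (mul_eq_zero.1 this).resolve_left hi
    linarith
  · intro htight r hr
    have h0 : ∑ i, c i * (b i - constraint A B i q) = 0 := by
      refine Finset.sum_eq_zero fun i _ => ?_
      by_cases hi : c i = 0
      · simp [hi]
      · rw [htight i hi, sub_self, mul_zero]
    rw [← hslack, sub_eq_zero] at h0
    exact h0 ▸ hmax hr

theorem finite_faces_polyhedron (hcompact : IsCompact (polyhedron A B b))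
    (hne : (polyhedron A B b).Nonempty) : (faces (polyhedron A B b)).Finite := by
  refine (Set.finite_range fun I : Set (Fin m) =>
    {p ∈ polyhedron A B b | ∀ i ∈ I, constraint A B i p = b i}).subset fun F hF => ?_
  obtain ⟨I, rfl⟩ := exists_tight_of_mem_faces hcompact hne hF
  exact ⟨I, rfl⟩

/-- On a chamber, the support function of the fiber in any fixed direction is affine. -/
theorem exists_affine_support (hcompact : IsCompact (polyhedron A B b)) {z : Fin nx → ℝ}
    (hz : z ∈ Prod.fst '' polyhedron A B b) (u : StrongDual ℝ (Fin ny → ℝ)) :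
    ∃ (g : (Fin nx → ℝ) →ₗ[ℝ] ℝ) (r : ℝ),
      (∀ x, ∀ y ∈ fiberMap (polyhedron A B b) x, u y ≤ r - g x) ∧
      ∀ x ∈ chamber (polyhedron A B b) z,
        ∃ y ∈ fiberMap (polyhedron A B b) x, u y = r - g x := by
  obtain ⟨⟨_, w⟩, hw, rfl⟩ := hz
  dsimp only
  rename_i z
  have hclosed : IsClosed {p : (Fin nx → ℝ) × (Fin ny → ℝ) | p.1 = z} :=
    isClosed_eq continuous_fst continuous_const
  obtain ⟨⟨z', y⟩, ⟨hy, rfl⟩, hmax⟩ := (hcompact.inter_right hclosed).exists_isMaxOn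
    ⟨(z, w), hw, rfl⟩ (u.continuous.comp continuous_snd).continuousOn
  have happ : ∀ i x y, constraint A B i (x, y) = (A *ᵥ x) i + (B *ᵥ y) i := fun i x y =>
    constraint_apply A B i (x, y)
  obtain ⟨c, hc, hu, huy⟩ := exists_multipliers_of_forall_le
    (fun i => LinearMap.proj i ∘ₗ B.mulVecLin) (fun i => b i - (A *ᵥ z') i) u.toLinearMap (p := y)
    (fun i => by
      have := (mem_polyhedron_iff A B b _).1 hy i
      rw [happ] at this
      simpa using by linarith)
    (fun q hq => hmax (a := (z', q)) ⟨(mem_polyhedron_iff A B b _).2 fun i => by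
      have := hq i
      simp only [LinearMap.comp_apply, LinearMap.proj_apply, Matrix.mulVecLin_apply] at this
      rw [happ]
      linarith, rfl⟩)
  simp only [ContinuousLinearMap.coe_coe, LinearMap.comp_apply, LinearMap.proj_apply,
    Matrix.mulVecLin_apply] at hu huy
  set g : (Fin nx → ℝ) →ₗ[ℝ] ℝ := ∑ i, c i • (LinearMap.proj i ∘ₗ A.mulVecLin) with hg
  have hgx : ∀ x, g x = ∑ i, c i * (A *ᵥ x) i := fun x => by
    simp [hg, LinearMap.sum_apply]
  have hle : ∀ p ∈ polyhedron A B b, g p.1 + u p.2 ≤ ∑ i, c i * b i := fun p hp => by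
    rw [hgx, hu, ← Finset.sum_add_distrib]
    refine Finset.sum_le_sum fun i _ => ?_
    rw [← mul_add, ← constraint_apply]
    exact mul_le_mul_of_nonneg_left ((mem_polyhedron_iff A B b p).1 hp i) (hc i)
  have heq : g z' + u y = ∑ i, c i * b i := by
    rw [hgx, huy, ← Finset.sum_add_distrib]
    exact Finset.sum_congr rfl fun i _ => by ring
  refine ⟨g, ∑ i, c i * b i, fun x y' hy' => ?_, fun x hx => ?_⟩
  · have := hle _ hy'
    dsimp only at this
    linarith
  -- The face of `l` meets the fiber over `z'`, so its projection is one of the sets intersected in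
  -- the chamber.
  · let l : StrongDual ℝ ((Fin nx → ℝ) × (Fin ny → ℝ)) := g.toContinuousLinearMap.coprod u
    have hl : ∀ p, l p = g p.1 + u p.2 := fun p => by simp [l]
    obtain ⟨⟨_, y'⟩, ⟨hy', hmax'⟩, rfl⟩ := hx _ ⟨l.toExposed _, ⟨l, rfl⟩, rfl, (z', y),
      ⟨hy, fun q hq => by rw [hl, hl, heq]; exact hle q hq⟩, rfl⟩
    refine ⟨y', hy', ?_⟩
    have h₁ := hmax' _ hy
    have h₂ := hle _ hy'
    rw [hl, hl] at h₁
    dsimp only at h₁ h₂ ⊢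
    linarith

theorem isCompact_fiberMap (hcompact : IsCompact (polyhedron A B b)) (x : Fin nx → ℝ) :
    IsCompact (fiberMap (polyhedron A B b) x) := by
  have hclosed : IsClosed {p : (Fin nx → ℝ) × (Fin ny → ℝ) | p.1 = x} :=
    isClosed_eq continuous_fst continuous_const
  have h : fiberMap (polyhedron A B b) x = Prod.snd '' (polyhedron A B b ∩ {p | p.1 = x}) := by
    ext y
    constructor
    · exact fun hy => ⟨(x, y), ⟨hy, rfl⟩, rfl⟩
    · rintro ⟨⟨_, _⟩, ⟨hp, rfl⟩, rfl⟩
      exact hp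
  rw [h]
  exact (hcompact.inter_right hclosed).image continuous_snd

theorem convex_fiberMap (x : Fin nx → ℝ) : Convex ℝ (fiberMap (polyhedron A B b) x) := by
  intro y₀ h₀ y₁ h₁ s t hs ht hst
  have h := convex_polyhedron A B b h₀ h₁ hs ht hst
  rwa [Prod.smul_mk, Prod.smul_mk, Prod.mk_add_mk, ← add_smul, hst, one_smul] at h

variable (A B b) in
theorem convex_chamber (z : Fin nx → ℝ) : Convex ℝ (chamber (polyhedron A B b) z) := by
  refine convex_sInter ?_
  rintro _ ⟨F, ⟨l, rfl⟩, rfl, -⟩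
  exact (ContinuousLinearMap.toExposed.isExposed.convex (convex_polyhedron A B b)).linear_image
    (LinearMap.fst ℝ _ _)

end Polyhedron

/-! ### Chambers and affinity of the fiber map -/

theorem chamber_subset {nx ny : ℕ} {D : Set ((Fin nx → ℝ) × (Fin ny → ℝ))} {z : Fin nx → ℝ}
    (hz : z ∈ Prod.fst '' D) : chamber D z ⊆ Prod.fst '' D := fun _ hx =>
  -- `D` is itself a face, exposed by the zero functional.
  hx _ ⟨D, ⟨0, by ext; simp [ContinuousLinearMap.toExposed]⟩, rfl, hz⟩

theorem setValuedDom_fiberMap {nx ny : ℕ} (D : Set ((Fin nx → ℝ) × (Fin ny → ℝ))) :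
    setValuedDom (fiberMap D) = Prod.fst '' D := by
  ext x
  constructor
  · rintro ⟨y, hy⟩
    exact ⟨(x, y), hy, rfl⟩
  · rintro ⟨⟨_, y⟩, hy, rfl⟩
    exact ⟨y, hy⟩

theorem sUnion_chamberComplex {nx ny : ℕ} (D : Set ((Fin nx → ℝ) × (Fin ny → ℝ))) :
    ⋃₀ chamberComplex D = Prod.fst '' D := by
  refine Set.Subset.antisymm ?_ fun x hx => ?_
  · refine Set.sUnion_subset ?_
    rintro _ ⟨z, hz, rfl⟩
    exact chamber_subset hz
  · refine ⟨chamber D x, ⟨x, hx, rfl⟩, ?_⟩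
    rintro _ ⟨F, -, -, hxF⟩
    exact hxF

theorem finite_chamberComplex {nx ny : ℕ} {D : Set ((Fin nx → ℝ) × (Fin ny → ℝ))}
    (hD : (faces D).Finite) : (chamberComplex D).Finite := by
  -- Each chamber is the intersection of a subfamily of the finitely many projected faces.
  refine ((hD.image fun F => Prod.fst '' F).finite_subsets.image Set.sInter).subset ?_
  rintro _ ⟨x, -, rfl⟩
  refine ⟨_, ?_, rfl⟩
  rintro _ ⟨F, hF, rfl, -⟩
  exact ⟨F, hF, rfl⟩

theorem isSetValuedAffineOn_chamber {m nx ny : ℕ} {A : Matrix (Fin m) (Fin nx) ℝ}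
    {B : Matrix (Fin m) (Fin ny) ℝ} {b : Fin m → ℝ} (hcompact : IsCompact (polyhedron A B b))
    {z : Fin nx → ℝ} (hz : z ∈ Prod.fst '' polyhedron A B b) :
    IsSetValuedAffineOn (fiberMap (polyhedron A B b)) (chamber (polyhedron A B b) z) := by
  refine ⟨convex_chamber A B b z, ?_, fun x₀ h₀ x₁ h₁ η hη => ?_⟩
  · rw [setValuedDom_fiberMap]
    exact chamber_subset hz
  obtain ⟨hη₀, hη₁⟩ := hη
  refine Set.Subset.antisymm (fun y hy => ?_) ?_
  · by_contra hnot
    -- A separating `u` would exceed at `y` the convex combination of the two fiber maxima,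
    -- contradicting affinity.
    obtain ⟨u, s, hlt, hsy⟩ := geometric_hahn_banach_closed_point
      (((convex_fiberMap x₁).smul η).add ((convex_fiberMap x₀).smul (1 - η)))
      (((isCompact_fiberMap hcompact x₁).smul η).add
        ((isCompact_fiberMap hcompact x₀).smul (1 - η))).isClosed hnot
    obtain ⟨g, r, hle, heq⟩ := exists_affine_support hcompact hz u
    obtain ⟨y₀, hy₀, hu₀⟩ := heq x₀ h₀
    obtain ⟨y₁, hy₁, hu₁⟩ := heq x₁ h₁
    have h := hle _ y hy
    have h' := hlt _ (Set.add_mem_add (Set.smul_mem_smul_set hy₁) (Set.smul_mem_smul_set hy₀))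
    simp only [map_add, map_smul, smul_eq_mul, hu₀, hu₁] at h h'
    have hid : η * (r - g x₁) + (1 - η) * (r - g x₀) = r - (η * g x₁ + (1 - η) * g x₀) := by ring
    linarith
  -- This inclusion is just convexity of the polyhedron.
  · rintro _ ⟨_, ⟨y₁, hy₁, rfl⟩, _, ⟨y₀, hy₀, rfl⟩, rfl⟩
    exact convex_polyhedron A B b hy₁ hy₀ hη₀.le (sub_nonneg.2 hη₁.le) (by ring)

theorem mainTheorem6 {m nx ny : ℕ} (A : Matrix (Fin m) (Fin nx) ℝ)
    (B : Matrix (Fin m) (Fin ny) ℝ) (b : Fin m → ℝ)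
    (hcompact : IsCompact (polyhedron A B b))
    (hfull : (interior (polyhedron A B b)).Nonempty) :
    IsPiecewiseAffineOver (fiberMap (polyhedron A B b)) (chamberComplex (polyhedron A B b)) ∧
      ∀ K ∈ chamberComplex (polyhedron A B b),
        IsSetValuedAffineOn (fiberMap (polyhedron A B b)) K := by
  have haff : ∀ K ∈ chamberComplex (polyhedron A B b),
      IsSetValuedAffineOn (fiberMap (polyhedron A B b)) K := by
    rintro _ ⟨z, hz, rfl⟩
    exact isSetValuedAffineOn_chamber hcompact hz
  exact ⟨⟨finite_chamberComplex
    (finite_faces_polyhedron hcompact (hfull.mono interior_subset)),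
    (setValuedDom_fiberMap _).trans (sUnion_chamberComplex _).symm, haff⟩, haff⟩
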